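/- Let $N$ players $i\in[N]$ have nonempty compact convex strategy sets $X_i\subseteq\mathbb{R}^{n_i}$ and real-valued objectives $f_i(x_i,x_{-i})$ (for instance expectations $\mathbb{E}[\tilde f_i(x_i,x_{-i},\xi)]$), and let $X=\prod_{i=1}^N X_i$. Suppose that for every $i$ and every $x_{-i}\in\prod_{j\neq i}X_j$ the function $f_i(\bullet,x_{-i})$ is Lipschitz continuous on an open set containing $X_i$ (the open set and the Lipschitz constant may depend on $x_{-i}$), and let $\partial^C_{x_i}f_i(x_i,x_{-i})=\{\zeta : \langle\zeta,d\rangle\le \limsup_{y\to x_i,\,t\downarrow 0}\tfrac{f_i(y+td,\,x_{-i})-f_i(y,\,x_{-i})}{t}\ \ \forall d\in\mathbb{R}^{n_i}\}$ denote the Clarke subdifferential of $f_i(\bullet,x_{-i})$ at $x_i$. Suppose further that the set-valued map $\mathbf F(x)=\prod_{i=1}^N\partial^C_{x_i}f_i(x_i,x_{-i})$ is upper semicontinuous on $X$, that is, for every $x\in X$ and every open set $V\supseteq\mathbf F(x)$ there is a neighbourhood $U$ of $x$ with $\mathbf F(x')\subseteq V$ for all $x'\in U\cap X$. Then the game has a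 Clarke–Nash equilibrium: a point $x^*\in X$ such that for every $i\in[N]$ $$0\in\partial^C_{x_i}f_i(x_i^*,x_{-i}^*)+\mathcal N_{X_i}(x_i^*),$$ where $\mathcal N_{X_i}(x_i^*)=\{v : \limsup_{y\to x_i^*,\ y\in X_i\setminus\{x_i^*\}}\langle v,y-x_i^*\rangle/\|y-x_i^*\|\le 0\}$ is the Fréchet normal cone (with the $\limsup$ read as $-\infty$ if $x_i^*$ is isolated in $X_i$). -/

import Mathlib

open Filter Topology
open scoped Pointwise

noncomputable section

namespace ClarkeGame

section Variational

variable {E : Type*} [NormedAddCommGroup E] [InnerProductSpace ℝ E]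

/-- Clarke's generalized directional derivative
`f°(x; d) = limsup_{y → x, t ↓ 0} (f (y + t d) - f y) / t`.
The limsup is taken in the extended reals; it is finite when `f` is Lipschitz near `x`. -/
def clarkeDirDeriv (f : E → ℝ) (x d : E) : EReal :=
  limsup (fun p : E × ℝ => (((f (p.1 + p.2 • d) - f p.1) / p.2 : ℝ) : EReal))
    (𝓝 x ×ˢ 𝓝[>] (0 : ℝ))

/-- The Clarke subdifferential `∂ᶜ f(x) = {ζ | ⟨ζ, d⟩ ≤ f°(x; d) for all d}`. -/
def clarkeSubdiff (f : E → ℝ) (x : E) : Set E :=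
  {ζ | ∀ d : E, ((inner ℝ ζ d : ℝ) : EReal) ≤ clarkeDirDeriv f x d}

/-- The Fréchet normal cone to `X` at a point `x` of `X`: the vectors `v` such that
`⟨v, y - x⟩ ≤ o(‖y - x‖)` as `y → x` in `X`. -/
def frechetNormalCone (X : Set E) (x : E) : Set E :=
  {v | x ∈ X ∧ ∀ ε : ℝ, 0 < ε → ∀ᶠ y in 𝓝[X] x, inner ℝ v (y - x) ≤ ε * ‖y - x‖}

end Variational

section Game

variable {N : ℕ} {n : Fin N → ℕ}

/-- Joint strategies: player `i` chooses a vector of `ℝ^{n i}`. -/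
abbrev Profile (n : Fin N → ℕ) : Type := ∀ i : Fin N, EuclideanSpace ℝ (Fin (n i))

/-- The function `f_i(•, x_{-i})` of player `i`'s own variable (it does not depend on `x i`). -/
def ownObjective (f : Fin N → Profile n → ℝ) (i : Fin N) (x : Profile n) :
    EuclideanSpace ℝ (Fin (n i)) → ℝ :=
  fun z => f i (Function.update x i z)

/-- The set-valued map `F(x) = ∏ i, ∂ᶜ_{x_i} f_i(x_i, x_{-i})`. -/
def subdiffMap (f : Fin N → Profile n → ℝ) (x : Profile n) : Set (Profile n) :=
  {y | ∀ i, y i ∈ clarkeSubdiff (ownObjective f i x) (x i)}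

/-- `x` is a Clarke–Nash equilibrium of the game with strategy sets `X i` and objectives `f i`:
each `x i` lies in `X i` and is a Clarke stationary point of `f_i(•, x_{-i})` on `X i`. -/
def IsClarkeNash (X : ∀ i : Fin N, Set (EuclideanSpace ℝ (Fin (n i))))
    (f : Fin N → Profile n → ℝ) (x : Profile n) : Prop :=
  ∀ i, x i ∈ X i ∧
    (0 : EuclideanSpace ℝ (Fin (n i))) ∈
      clarkeSubdiff (ownObjective f i x) (x i) + frechetNormalCone (X i) (x i)

end Game

end ClarkeGame

end

/-! An equilibrium solves a variational inequality: it suffices to find `x` in the product of the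
strategy sets and `y` in `subdiffMap f x` with `∑ i, ⟨y i, z i - x i⟩ ≥ 0` for every admissible `z`.
Letting `z` differ from `x` in one component shows that `-y i` is normal to `X i` at `x i`, so `0 =
y i + (-y i)` has the required form. Clarke subdifferentials of locally Lipschitz functions are
nonempty (Hahn–Banach, as `f°` is sublinear), convex and compact. For an upper hemicontinuous map
with such values, suppose the inequality has no solution. Sion's minimax theorem gives for each `x`
one `z` that violates it against all `y ∈ K x`; upper hemicontinuity makes this relation open in
`x`; Fan–Browder then places some `x` in the convex hull of its own violating points, hence in an
open half-space with `x` on its boundary. Fan–Browder reduces to a KKM-type covering property of the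
simplex, obtained from Scarf's lemma, a parity count, on fine grids. -/

/-! ### Scarf's lemma by parity -/

section Scarf

variable {V I : Type*}

/-- A set `S` is dominant for the rankings `r i` if no element of `V` is strictly above
the `r i`-minimum of `S` for every `i` simultaneously. -/
def Scarf.Dominant (r : I → V → ℤ) (S : Finset V) : Prop :=
  ∀ t, ∃ i, ∀ s ∈ S, r i t ≤ r i s

theorem Scarf.Dominant.mono {r : I → V → ℤ} {S T : Finset V} (h : Scarf.Dominant r T)
    (hST : S ⊆ T) : Scarf.Dominant r S := fun t =>
  let ⟨i, hi⟩ := h t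
  ⟨i, fun s hs => hi s (hST hs)⟩

/-- In a surjection onto a set with one element fewer there is exactly one collision. -/
theorem Finset.exists_unique_collision [DecidableEq I] [Fintype I] {D : Finset V} {m : I → V} (hm : ∀ i, m i ∈ D)
    (hsurj : ∀ s ∈ D, ∃ i, m i = s) (hcard : D.card + 1 = Fintype.card I) :
    ∃ i j, i ≠ j ∧ m i = m j ∧ ∀ a b, a ≠ b → m a = m b → (a = i ∨ a = j) := by
  obtain ⟨i, -, j, -, hij, h⟩ := Finset.exists_ne_map_eq_of_card_lt_of_maps_to
    (s := (Finset.univ : Finset I)) (t := D) (f := m) (by simp; omega) (fun i _ => hm i)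
  refine ⟨i, j, hij, h, fun a b hab hmab => ?_⟩
  by_contra! hcon
  have hinj : Set.InjOn m ((Finset.univ.erase i : Finset I) : Set I) := by
    refine Finset.injOn_of_surjOn_of_card_le (t := D) m (fun k _ => hm k) (fun s hs => ?_) ?_
    · obtain ⟨k, rfl⟩ := hsurj s hs
      by_cases hk : k = i
      · exact ⟨j, by simp [hij.symm], by rw [hk, h]⟩
      · exact ⟨k, by simp [hk], rfl⟩
    · rw [Finset.card_erase_of_mem (Finset.mem_univ i), Finset.card_univ]; omega
  have ha : a ∈ ((Finset.univ.erase i : Finset I) : Set I) := by simp [hcon.1]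
  by_cases hb : b = i
  · exact hcon.2 (hinj ha (by simp [hij.symm]) (by rw [hmab, hb, h]))
  · exact hab (hinj ha (by simp [hb]) hmab)

/-- The ways to complete a dominant set `D` with `|I| - 1` elements to a dominant set with `|I|`
elements: there are two indices `i ≠ j` with the same minimum, and a completion
is an `r k`-maximal element among those above the minima for the indices other than `k`,
with `k = i` or `k = j`. -/
theorem Scarf.Dominant.completions [DecidableEq V] [DecidableEq I] [Fintype I] {r : I → V → ℤ} (hr : ∀ i, Function.Injective (r i))
    {D : Finset V} (hD : Scarf.Dominant r D) (hcard : D.card + 1 = Fintype.card I)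
    (hne : D.Nonempty) :
    ∃ (m : I → V) (i j : I), (∀ k, m k ∈ D) ∧ (∀ k, ∀ s ∈ D, r k (m k) ≤ r k s) ∧ i ≠ j ∧
      m i = m j ∧ (∀ s ∈ D, ∃ l, l ≠ i ∧ m l = s) ∧ (∀ s ∈ D, ∃ l, l ≠ j ∧ m l = s) ∧
      ∀ t, (t ∉ D ∧ Scarf.Dominant r (insert t D)) ↔
        ∃ k, (k = i ∨ k = j) ∧ (∀ l, l ≠ k → r l (m l) < r l t) ∧
          ∀ u, (∀ l, l ≠ k → r l (m l) < r l u) → r k u ≤ r k t := by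
  choose m hmD hmin using fun k => D.exists_min_image (r k) hne
  have hsurj : ∀ s ∈ D, ∃ i, m i = s := fun s hs => by
    obtain ⟨i, hi⟩ := hD s
    exact ⟨i, hr i (le_antisymm (hmin i s hs) (hi _ (hmD i)))⟩
  obtain ⟨i, j, hij, hmij, hcol⟩ := Finset.exists_unique_collision hmD hsurj hcard
  have hsi : ∀ s ∈ D, ∃ l, l ≠ i ∧ m l = s := fun s hs => by
    obtain ⟨l, rfl⟩ := hsurj s hs
    by_cases h : l = i
    · exact ⟨j, hij.symm, by rw [h, hmij]⟩
    · exact ⟨l, h, rfl⟩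
  have hsj : ∀ s ∈ D, ∃ l, l ≠ j ∧ m l = s := fun s hs => by
    obtain ⟨l, rfl⟩ := hsurj s hs
    by_cases h : l = j
    · exact ⟨i, hij, by rw [h, hmij]⟩
    · exact ⟨l, h, rfl⟩
  refine ⟨m, i, j, hmD, hmin, hij, hmij, hsi, hsj, fun t => ⟨?_, ?_⟩⟩
  · rintro ⟨htD, ht⟩
    obtain ⟨k, hk⟩ := ht t
    have hit : ∀ s ∈ D, ∃ l, l ≠ k ∧ m l = s ∧ r l (m l) < r l t := fun s hs => by
      obtain ⟨l, hl⟩ := ht s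
      have hls : m l = s :=
        hr l (le_antisymm (hmin l s hs) (hl _ (Finset.mem_insert_of_mem (hmD l))))
      have hlt : r l s < r l t := lt_of_le_of_ne (hl t (Finset.mem_insert_self _ _))
        fun h => htD (hr l h ▸ hs)
      refine ⟨l, ?_, hls, hls ▸ hlt⟩
      rintro rfl
      exact absurd (hk s (Finset.mem_insert_of_mem hs)) (not_le.2 hlt)
    have hM : ∀ l, l ≠ k → r l (m l) < r l t := fun l hl => by
      obtain ⟨l', hl'k, hl', hlt⟩ := hit (m l) (hmD l)
      by_cases hll : l' = l
      · exact hll ▸ hlt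
      -- Otherwise `k`, `l`, `l'` are three distinct indices in the colliding pair `{i, j}`.
      · obtain ⟨q, hqk, hq, -⟩ := hit (m k) (hmD k)
        have h1 := hcol k q (Ne.symm hqk) hq.symm
        have h2 := hcol l l' (Ne.symm hll) hl'.symm
        have h3 := hcol l' l hll hl'
        grind
    refine ⟨k, ?_, hM, fun u hu => ?_⟩
    · obtain ⟨q, hqk, hq, -⟩ := hit (m k) (hmD k)
      exact hcol k q (Ne.symm hqk) hq.symm
    · obtain ⟨l, hl⟩ := ht u
      by_cases hlk : l = k
      · exact hlk ▸ hl t (Finset.mem_insert_self _ _)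
      · exact absurd (hl _ (Finset.mem_insert_of_mem (hmD l))) (not_le.2 (hu l hlk))
  · rintro ⟨k, hk, hM, hmax⟩
    have hsk : ∀ s ∈ D, ∃ l, l ≠ k ∧ m l = s := by
      rcases hk with rfl | rfl
      · exact hsi
      · exact hsj
    refine ⟨fun htD => ?_, fun u => ?_⟩
    · obtain ⟨l, hl, rfl⟩ := hsk t htD
      exact lt_irrefl _ (hM l hl)
    · by_cases hu : ∀ l, l ≠ k → r l (m l) < r l u
      · refine ⟨k, fun s hs => ?_⟩
        rcases Finset.mem_insert.1 hs with rfl | hs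
        · exact hmax u hu
        · obtain ⟨q, hq⟩ := hD t
          by_cases hqk : q = k
          · exact (hmax u hu).trans (hqk ▸ hq s hs)
          · exact absurd (hq _ (hmD q)) (not_le.2 (hM q hqk))
      · push Not at hu
        obtain ⟨l, hl, hlu⟩ := hu
        refine ⟨l, fun s hs => ?_⟩
        rcases Finset.mem_insert.1 hs with rfl | hs
        · exact hlu.trans (hM l hl).le
        · exact hlu.trans (hmin l s hs)

/-- A dominant set `D` with `|I| - 1` elements, not consisting of the slack elements `e i` only,
has exactly two completions to a dominant set with `|I|` elements. -/
theorem Scarf.Dominant.card_completions_eq_two [DecidableEq V] [DecidableEq I]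
    [Fintype V] [Fintype I] {r : I → V → ℤ}
    (hr : ∀ i, Function.Injective (r i)) {e : I → V}
    (htop : ∀ i j v, i ≠ j → v ∉ Set.range e → r i v < r i (e j))
    {D : Finset V} (hD : Scarf.Dominant r D) (hcard : D.card + 1 = Fintype.card I)
    {v : V} (hv : v ∈ D) (hve : v ∉ Set.range e) {A : Finset V}
    (hA : ∀ t, t ∈ A ↔ t ∉ D ∧ Scarf.Dominant r (insert t D)) : A.card = 2 := by
  obtain ⟨m, i, j, hmD, hmin, hij, hmij, hsi, hsj, hiff⟩ := hD.completions hr hcard ⟨v, hv⟩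
  have hex : ∀ k, ∃ t, (∀ l, l ≠ k → r l (m l) < r l t) ∧
      ∀ u, (∀ l, l ≠ k → r l (m l) < r l u) → r k u ≤ r k t := fun k => by
    obtain ⟨t, ht, hmax⟩ := Finset.exists_max_image
      (Finset.univ.filter fun t => ∀ l, l ≠ k → r l (m l) < r l t) (r k)
      -- The slack `e k` is a candidate because the non-slack `v ∈ D` bounds each minimum from
      -- above.
      ⟨e k, by simpa using fun l hl => (hmin l v hv).trans_lt (htop l k v hl hve)⟩
    exact ⟨t, by simpa using ht, fun u hu => hmax u (by simpa using hu)⟩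
  choose t ht hmax using hex
  have huniq : ∀ k s, (∀ l, l ≠ k → r l (m l) < r l s) →
      (∀ u, (∀ l, l ≠ k → r l (m l) < r l u) → r k u ≤ r k s) → s = t k := fun k s h1 h2 =>
    hr k (le_antisymm (hmax k s h1) (h2 _ (ht k)))
  rw [Finset.card_eq_two]
  refine ⟨t i, t j, fun h => ?_, ?_⟩
  · obtain ⟨q, hq⟩ := hD (t i)
    by_cases hqi : q = i
    · exact absurd (hq _ (hmD q)) (not_le.2 (by subst hqi; rw [h]; exact ht j q hij))
    · exact absurd (hq _ (hmD q)) (not_le.2 (ht i q hqi))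
  · ext s
    rw [hA, hiff, Finset.mem_insert, Finset.mem_singleton]
    constructor
    · rintro ⟨k, rfl | rfl, h1, h2⟩
      · exact Or.inl (huniq _ _ h1 h2)
      · exact Or.inr (huniq _ _ h1 h2)
    · rintro (rfl | rfl)
      · exact ⟨i, Or.inl rfl, ht i, hmax i⟩
      · exact ⟨j, Or.inr rfl, ht j, hmax j⟩

/-- A set of all slack elements but one has exactly one completion. -/
theorem Scarf.card_completions_slack [DecidableEq V] [DecidableEq I] [Fintype V] [Fintype I]
    {r : I → V → ℤ} (hr : ∀ i, Function.Injective (r i)) {e : I → V} (he : Function.Injective e)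
    (hbot : ∀ i v, r i (e i) ≤ r i v)
    (htop : ∀ i j v, i ≠ j → v ∉ Set.range e → r i v < r i (e j))
    (i₀ : I) {A : Finset V}
    (hA : ∀ t, t ∈ A ↔ t ∉ (Finset.univ.erase i₀).image e ∧
      Scarf.Dominant r (insert t ((Finset.univ.erase i₀).image e))) : A.card = 1 := by
  set D := (Finset.univ.erase i₀).image e with hDdef
  have hmem : ∀ s, s ∈ D ↔ ∃ i, i ≠ i₀ ∧ e i = s := fun s => by simp [hDdef]
  obtain ⟨t₀, ht₀, hmax⟩ := Finset.exists_max_image (Finset.univ \ D) (r i₀)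
    ⟨e i₀, by simpa [hmem] using fun i hi h => hi (he h)⟩
  simp only [Finset.mem_sdiff, Finset.mem_univ, true_and] at ht₀ hmax
  rw [Finset.card_eq_one]
  refine ⟨t₀, ?_⟩
  ext t
  rw [hA, Finset.mem_singleton]
  constructor
  · rintro ⟨htD, ht⟩
    obtain ⟨i, hi⟩ := ht t₀
    by_cases hii : i = i₀
    · subst hii
      exact hr i (le_antisymm (hmax t htD) (hi t (Finset.mem_insert_self _ _)))
    · have hei : e i ∈ D := (hmem _).2 ⟨i, hii, rfl⟩
      have := hr i (le_antisymm (hi _ (Finset.mem_insert_of_mem hei)) (hbot i t₀))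
      exact absurd (this ▸ hei) ht₀
  · rintro rfl
    refine ⟨ht₀, fun u => ?_⟩
    by_cases hu : u ∈ D
    · obtain ⟨l, -, rfl⟩ := (hmem u).1 hu
      exact ⟨l, fun s _ => hbot l s⟩
    · refine ⟨i₀, fun s hs => ?_⟩
      rcases Finset.mem_insert.1 hs with rfl | hs
      · exact hmax u hu
      · obtain ⟨l, hl, rfl⟩ := (hmem s).1 hs
        by_cases hue : u ∈ Set.range e
        · obtain ⟨q, rfl⟩ := hue
          by_cases hq : q = i₀
          · exact hq ▸ hbot q _
          · exact absurd ((hmem _).2 ⟨q, hq, rfl⟩) hu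
        · exact (htop i₀ l u (Ne.symm hl) hue).le

/-- A set `R` of `|I|` coloured points has an even number of facets coloured by all colours but
`i₀`, unless all colours occur in `R`. -/
theorem Finset.even_card_facets [DecidableEq V] [DecidableEq I] [Fintype I] (c : V → I) (i₀ : I)
    {R : Finset V} (hR : R.card = Fintype.card I) (hcol : R.image c ≠ Finset.univ) :
    Even (R.filter fun x => (R.erase x).image c = Finset.univ.erase i₀).card := by
  rcases Finset.eq_empty_or_nonempty
    (R.filter fun x => (R.erase x).image c = Finset.univ.erase i₀) with h | ⟨x, hx⟩
  · simp [h]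
  · obtain ⟨hxR, hx⟩ := Finset.mem_filter.1 hx
    -- One such facet forces exactly one repeated colour, shared by `x` and some `y`; only removing
    -- `x` or `y` gives such a facet.
    have hinj : Set.InjOn c (R.erase x : Finset V) := by
      rw [← Finset.card_image_iff, hx, Finset.card_erase_of_mem (Finset.mem_univ _),
        Finset.card_erase_of_mem hxR, hR, Finset.card_univ]
    have hcx : c x ≠ i₀ := fun h => hcol <| by
      rw [← Finset.insert_erase hxR, Finset.image_insert, hx, h,
        Finset.insert_erase (Finset.mem_univ _)]
    obtain ⟨y, hy, hyx⟩ : ∃ y ∈ R.erase x, c y = c x := by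
      rw [← Finset.mem_image, hx]; simp [hcx]
    have hyx' := Finset.ne_of_mem_erase hy
    have hyR := Finset.mem_of_mem_erase hy
    suffices h : (R.filter fun x => (R.erase x).image c = Finset.univ.erase i₀) = {x, y} by
      rw [h, Finset.card_pair hyx'.symm]; exact even_two
    ext z
    simp only [Finset.mem_filter, Finset.mem_insert, Finset.mem_singleton]
    constructor
    · rintro ⟨hzR, hz⟩
      by_contra! hcon
      have hinj' : Set.InjOn c (R.erase z : Finset V) := by
        rw [← Finset.card_image_iff, hz, Finset.card_erase_of_mem (Finset.mem_univ _),
          Finset.card_erase_of_mem hzR, hR, Finset.card_univ]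
      exact hyx' (hinj' (by simp [hyR, hcon.2.symm]) (by simp [hxR, hcon.1.symm]) hyx)
    · rintro (rfl | rfl)
      · exact ⟨hxR, hx⟩
      · refine ⟨hyR, ?_⟩
        rw [← hx]
        ext a
        simp only [Finset.mem_image, Finset.mem_erase]
        constructor
        · rintro ⟨b, ⟨hb, hbR⟩, rfl⟩
          by_cases hbx : b = x
          · exact ⟨z, ⟨hyx', hyR⟩, by rw [hbx, hyx]⟩
          · exact ⟨b, ⟨hbx, hbR⟩, rfl⟩
        · rintro ⟨b, ⟨hb, hbR⟩, rfl⟩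
          by_cases hbx : b = z
          · exact ⟨x, ⟨hyx'.symm, hxR⟩, by rw [hbx, hyx]⟩
          · exact ⟨b, ⟨hbx, hbR⟩, rfl⟩

/-- Scarf's lemma: for any colouring extending the natural one of the slack elements there is
a dominant set with `|I|` elements which has all colours. -/
theorem Scarf.exists_dominant_image_eq_univ [DecidableEq V] [DecidableEq I] [Fintype V] [Fintype I]
    [Nonempty I] {r : I → V → ℤ} (hr : ∀ i, Function.Injective (r i)) {e : I → V}
    (hbot : ∀ i v, r i (e i) ≤ r i v)
    (htop : ∀ i j v, i ≠ j → v ∉ Set.range e → r i v < r i (e j))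
    {c : V → I} (hc : ∀ i, c (e i) = i) :
    ∃ R : Finset V, R.card = Fintype.card I ∧ Scarf.Dominant r R ∧ R.image c = Finset.univ := by
  classical
  by_contra! hcon
  obtain ⟨i₀⟩ := ‹Nonempty I›
  have he : Function.Injective e := fun i j h => by rw [← hc i, h, hc]
  have hI : 0 < Fintype.card I := Fintype.card_pos_iff.2 ⟨i₀⟩
  set rooms : Finset (Finset V) :=
    Finset.univ.filter fun R => R.card = Fintype.card I ∧ Scarf.Dominant r R with hrooms
  set doors : Finset (Finset V) := Finset.univ.filter fun D =>
    D.card + 1 = Fintype.card I ∧ Scarf.Dominant r D ∧ D.image c = Finset.univ.erase i₀ with hdoors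
  set D₀ : Finset V := (Finset.univ.erase i₀).image e with hD₀
  -- Count incidences of doors with rooms twice. Without a fully coloured room every room has evenly
  -- many doors, while every door lies in two rooms except `D₀`, which lies in one.
  have hcount := Finset.sum_card_bipartiteAbove_eq_sum_card_bipartiteBelow
    (s := rooms) (t := doors) (fun R D => D ⊆ R)
  have hroom : ∀ R ∈ rooms, Even (doors.bipartiteAbove (fun R D => D ⊆ R) R).card := by
    intro R hR
    obtain ⟨-, hRc, hRd⟩ := Finset.mem_filter.1 hR
    have h := Finset.even_card_facets c i₀ hRc (hcon R hRc hRd)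
    convert h using 1
    symm
    refine Finset.card_bij (fun x _ => R.erase x) ?_ ?_ ?_
    · intro x hx
      obtain ⟨hxR, hx⟩ := Finset.mem_filter.1 hx
      simp only [Finset.mem_bipartiteAbove, hdoors, Finset.mem_filter, Finset.mem_univ, true_and]
      refine ⟨⟨?_, hRd.mono (Finset.erase_subset _ _), hx⟩, Finset.erase_subset _ _⟩
      rw [Finset.card_erase_of_mem hxR, hRc]; omega
    · intro x hx y hy hxy
      exact Finset.erase_injOn R (Finset.mem_filter.1 hx).1 (Finset.mem_filter.1 hy).1 hxy
    · intro D hD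
      simp only [Finset.mem_bipartiteAbove, hdoors, Finset.mem_filter, Finset.mem_univ,
        true_and] at hD
      obtain ⟨⟨hDc, -, hDi⟩, hDR⟩ := hD
      obtain ⟨x, hx, rfl⟩ := (Finset.covBy_iff_exists_insert.1
        (Finset.covBy_iff_card_sdiff_eq_one.2 ⟨hDR, by rw [Finset.card_sdiff_of_subset hDR]; omega⟩))
      have : (insert x D).erase x = D := Finset.erase_insert hx
      exact ⟨x, by simp only [Finset.mem_filter, this]; exact ⟨Finset.mem_insert_self _ _, hDi⟩, this⟩
  have hdoor : ∀ D ∈ doors, (rooms.bipartiteBelow (fun R D => D ⊆ R) D).card =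
      (Finset.univ.filter fun t => t ∉ D ∧ Scarf.Dominant r (insert t D)).card := by
    intro D hD
    obtain ⟨-, hDc, -, -⟩ := Finset.mem_filter.1 hD
    symm
    refine Finset.card_bij (fun x _ => insert x D) ?_ ?_ ?_
    · intro x hx
      obtain ⟨-, hxD, hx⟩ := Finset.mem_filter.1 hx
      simp only [Finset.mem_bipartiteBelow, hrooms, Finset.mem_filter, Finset.mem_univ, true_and]
      exact ⟨⟨by rw [Finset.card_insert_of_notMem hxD, hDc], hx⟩, Finset.subset_insert _ _⟩
    · intro x hx y hy hxy
      exact (Finset.insert_inj (Finset.mem_filter.1 hx).2.1).1 hxy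
    · intro R hR
      simp only [Finset.mem_bipartiteBelow, hrooms, Finset.mem_filter, Finset.mem_univ,
        true_and] at hR
      obtain ⟨⟨hRc, hRd⟩, hDR⟩ := hR
      obtain ⟨x, hx, rfl⟩ := (Finset.covBy_iff_exists_insert.1
        (Finset.covBy_iff_card_sdiff_eq_one.2 ⟨hDR, by rw [Finset.card_sdiff_of_subset hDR]; omega⟩))
      exact ⟨x, by simpa using ⟨hx, hRd⟩, rfl⟩
  have hD₀mem : D₀ ∈ doors := by
    simp only [hdoors, Finset.mem_filter, Finset.mem_univ, true_and]
    refine ⟨?_, fun t => ?_, ?_⟩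
    · rw [hD₀, Finset.card_image_of_injective _ he, Finset.card_erase_of_mem (Finset.mem_univ _),
        Finset.card_univ]
      omega
    · by_cases ht : t ∈ D₀
      · obtain ⟨l, -, rfl⟩ := Finset.mem_image.1 ht
        exact ⟨l, fun s _ => hbot l s⟩
      · refine ⟨i₀, fun s hs => ?_⟩
        obtain ⟨l, hl, rfl⟩ := Finset.mem_image.1 hs
        by_cases hte : t ∈ Set.range e
        · obtain ⟨q, rfl⟩ := hte
          by_cases hq : q = i₀
          · exact hq ▸ hbot q _
          · exact absurd (Finset.mem_image_of_mem e (by simp [hq])) ht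
        · exact (htop i₀ l t (Ne.symm (Finset.ne_of_mem_erase hl)) hte).le
    · rw [hD₀, Finset.image_image]
      simp [Function.comp_def, hc]
  have hslack : (rooms.bipartiteBelow (fun R D => D ⊆ R) D₀).card = 1 := by
    rw [hdoor D₀ hD₀mem]
    exact Scarf.card_completions_slack hr he hbot htop i₀ (fun t => by simp [hD₀])
  have hother : ∀ D ∈ doors.erase D₀, Even (rooms.bipartiteBelow (fun R D => D ⊆ R) D).card := by
    intro D hD
    obtain ⟨hne, hD⟩ := Finset.mem_erase.1 hD
    obtain ⟨-, hDc, hDd, hDi⟩ := Finset.mem_filter.1 hD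
    rw [hdoor D hD]
    obtain ⟨v, hv, hve⟩ : ∃ v ∈ D, v ∉ Set.range e := by
      by_contra! h
      refine hne (Finset.eq_of_subset_of_card_le (fun v hv => ?_) ?_)
      · obtain ⟨i, rfl⟩ := h v hv
        have : c (e i) ∈ D.image c := Finset.mem_image_of_mem c hv
        rw [hDi, hc] at this
        exact Finset.mem_image_of_mem e this
      · have := (Finset.mem_filter.1 hD₀mem).2.1
        omega
    rw [hDd.card_completions_eq_two hr htop hDc hv hve (A := Finset.univ.filter fun t =>
      t ∉ D ∧ Scarf.Dominant r (insert t D)) (fun t => by simp)]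
    exact even_two
  rw [← Finset.add_sum_erase doors _ hD₀mem, hslack] at hcount
  have h1 := Finset.even_sum _ hroom
  have h2 := Finset.even_sum _ hother
  rw [hcount] at h1
  exact absurd (h2.one_add) (Nat.not_odd_iff_even.2 h1)

/-- Scarf's lemma without slack elements: for points `t : T` ranked by `ρ i`, `i : I`, and
coloured by `c : T → I`, there are a nonempty set `C` of colours and points `s i` of colour `i`,
`i ∈ C`, such that no point is above all of them in all rankings `ρ i`, `i ∈ C`. -/
theorem Scarf.exists_colorful {T : Type*} [Finite T] [Nonempty T] [Finite I] [Nonempty I]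
    {ρ : I → T → ℤ} (hρ : ∀ i, Function.Injective (ρ i)) (c : T → I) :
    ∃ (C : Finset I) (s : I → T), C.Nonempty ∧ (∀ i ∈ C, c (s i) = i) ∧
      ∀ t, ∃ i ∈ C, ∀ j ∈ C, ρ i t ≤ ρ i (s j) := by
  classical
  cases nonempty_fintype T
  cases nonempty_fintype I
  obtain ⟨B, hB⟩ : ∃ B : ℤ, ∀ i t, |ρ i t| < B := by
    obtain ⟨B, hB⟩ := (Set.finite_range fun p : I × T => |ρ p.1 p.2|).bddAbove
    exact ⟨B + 1, fun i t => Int.lt_add_one_iff.2 (hB ⟨(i, t), rfl⟩)⟩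
  have hB0 : 0 < B := (abs_nonneg _).trans_lt (hB (Classical.arbitrary I) (Classical.arbitrary T))
  -- Slack `i` goes below everything in ranking `i`; the other slacks go above all points, with ties
  -- broken by a numbering of `I`.
  let r : I → T ⊕ I → ℤ := fun i => Sum.elim (ρ i)
    fun j => if j = i then -B else B + (Fintype.equivFin I j : ℕ)
  have hr : ∀ i, Function.Injective (r i) := by
    rintro i (t | j) (t' | j') h
    · exact congrArg _ (hρ i h)
    · have := abs_lt.1 (hB i t)
      simp only [r, Sum.elim_inl, Sum.elim_inr] at h
      split_ifs at h <;> omega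
    · have := abs_lt.1 (hB i t')
      simp only [r, Sum.elim_inl, Sum.elim_inr] at h
      split_ifs at h <;> omega
    · simp only [r, Sum.elim_inr] at h
      split_ifs at h with h1 h2 h2
      · rw [h1, h2]
      · omega
      · omega
      · exact congrArg _ ((Fintype.equivFin I).injective (Fin.ext (by omega)))
  obtain ⟨R, hRc, hRd, hRi⟩ := Scarf.exists_dominant_image_eq_univ hr (e := Sum.inr)
    (c := Sum.elim c id)
    (by
      rintro i (t | j)
      · have := abs_lt.1 (hB i t)
        simp only [r, Sum.elim_inl, Sum.elim_inr, if_true]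
        omega
      · simp only [r, Sum.elim_inr, if_true]
        split_ifs <;> omega)
    (by
      rintro i j (t | q) hij hv
      · have := abs_lt.1 (hB i t)
        simp only [r, Sum.elim_inl, Sum.elim_inr, if_neg hij.symm]
        omega
      · exact absurd ⟨q, rfl⟩ hv)
    (fun i => rfl)
  have hcol : ∀ i, ∃ t, Sum.inr i ∉ R → Sum.inl t ∈ R ∧ c t = i := fun i => by
    have : i ∈ R.image (Sum.elim c id) := hRi ▸ Finset.mem_univ i
    obtain ⟨t | j, hR, h⟩ := Finset.mem_image.1 this
    · exact ⟨t, fun _ => ⟨hR, h⟩⟩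
    · exact ⟨Classical.arbitrary T, fun hi => absurd ((show j = i from h) ▸ hR) hi⟩
  choose s hs using hcol
  have hdom : ∀ t, ∃ i, Sum.inr i ∉ R ∧ ∀ j, Sum.inr j ∉ R → ρ i t ≤ ρ i (s j) := fun t => by
    obtain ⟨i, hi⟩ := hRd (Sum.inl t)
    -- If slack `i` were in `R`, the minimum in ranking `i` would be at most `-B`, below every
    -- point.
    refine ⟨i, fun hiR => ?_, fun j hj => hi _ (hs j hj).1⟩
    have h1 := hi _ hiR
    have h2 := abs_lt.1 (hB i t)
    simp only [r, Sum.elim_inl, Sum.elim_inr, if_true] at h1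
    omega
  refine ⟨Finset.univ.filter fun i => Sum.inr i ∉ R, s, ?_, ?_, ?_⟩
  · obtain ⟨i, hi, -⟩ := hdom (Classical.arbitrary T)
    exact ⟨i, by simpa using hi⟩
  · intro i hi
    exact (hs i (by simpa using hi)).2
  · simpa using hdom

end Scarf

/-! ### From grid colourings to open covers of the simplex -/

/-- A combinatorial covering lemma on the grid of integer points of a dilated simplex: near
some grid point `p` there are grid points of every colour `i` with `p i ≠ 0`. -/
theorem Finset.exists_piAntidiag_colorful {I : Type*} [Fintype I] [DecidableEq I] [Nonempty I]
    (k : ℕ) (c : (I → ℕ) → I) :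
    ∃ p : I → ℕ, ∑ i, p i = k ∧ ∀ i, p i ≠ 0 → ∃ s : I → ℕ, ∑ l, s l = k ∧ c s = i ∧
      ∀ l, s l ≤ p l + Fintype.card I ∧ p l ≤ s l + Fintype.card I := by
  let T := {t : I → ℕ // t ∈ Finset.piAntidiag (Finset.univ : Finset I) k}
  have hT : ∀ t : T, ∑ i, t.1 i = k := fun t => (Finset.mem_piAntidiag.1 t.2).1
  have mk : ∀ t : I → ℕ, ∑ i, t i = k → t ∈ Finset.piAntidiag (Finset.univ : Finset I) k :=
    fun t ht => Finset.mem_piAntidiag.2 ⟨ht, fun i _ => Finset.mem_univ i⟩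
  have : Nonempty T := ⟨⟨Pi.single (Classical.arbitrary I) k, mk _ (by simp)⟩⟩
  let idx := Fintype.equivFin T
  -- Rank by the `i`-th coordinate, with ties broken by the numbering `idx`.
  let ρ : I → T → ℤ := fun i t => ((t.1 i * Fintype.card T + idx t : ℕ) : ℤ)
  have hle : ∀ i t t', ρ i t ≤ ρ i t' → t.1 i ≤ t'.1 i := fun i t t' h => by
    by_contra! hlt
    have h1 : t.1 i * Fintype.card T + idx t ≤ t'.1 i * Fintype.card T + idx t' :=
      Int.ofNat_le.1 h
    have h2 : (t'.1 i + 1) * Fintype.card T ≤ t.1 i * Fintype.card T :=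
      Nat.mul_le_mul_right _ hlt
    have h3 := (idx t').2
    rw [add_one_mul] at h2
    omega
  have hρ : ∀ i, Function.Injective (ρ i) := fun i t t' h => by
    have h0 := le_antisymm (hle i _ _ h.le) (hle i _ _ h.ge)
    have h1 : t.1 i * Fintype.card T + idx t = t'.1 i * Fintype.card T + idx t' :=
      Int.ofNat_inj.1 h
    rw [h0] at h1
    exact idx.injective (Fin.ext (by omega))
  obtain ⟨C, s, ⟨j₀, hj₀⟩, hs, hdom⟩ := Scarf.exists_colorful hρ (fun t => c t.1)
  let m : I → ℕ := fun l => if l ∈ C then C.inf' ⟨j₀, hj₀⟩ (fun j => (s j).1 l) else 0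
  have hms : ∀ j ∈ C, ∀ l, m l ≤ (s j).1 l := fun j hj l => by
    by_cases hl : l ∈ C
    · simpa only [m, if_pos hl] using Finset.inf'_le _ hj
    · simp [m, hl]
  have hmk : ∑ l, m l ≤ k := (Finset.sum_le_sum fun l _ => hms j₀ hj₀ l).trans (hT _).le
  -- With a larger deficit, all coordinates of `m` could be raised by one within total `k`, giving a
  -- grid point that contradicts `hdom`.
  have hkm : k ≤ ∑ l, m l + Fintype.card I := by
    by_contra! hlt
    let q : I → ℕ := fun l => m l + 1
    have hq : ∑ l, q l ≤ k := by
      simp only [q, Finset.sum_add_distrib, Finset.sum_const, smul_eq_mul, mul_one,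
        Finset.card_univ]
      omega
    obtain ⟨i, hiC, hi⟩ := hdom ⟨fun l => q l + Pi.single (M := fun _ => ℕ) j₀ (k - ∑ l, q l) l,
      mk _ (by rw [Finset.sum_add_distrib]; simp; omega)⟩
    have h1 : q i ≤ m i := by
      simp only [m, if_pos hiC]
      refine Finset.le_inf' _ _ fun j hj => le_trans (Nat.le_add_right _ _) (hle i _ _ (hi j hj))
    simp [q] at h1
  have hsm : ∀ j ∈ C, ∀ l, (s j).1 l ≤ m l + Fintype.card I := fun j hj l => by
    have h1 : ∑ l, ((s j).1 l - m l) + ∑ l, m l = k := by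
      rw [← Finset.sum_add_distrib]
      exact (Finset.sum_congr rfl fun l _ => Nat.sub_add_cancel (hms j hj l)).trans (hT (s j))
    have h2 : (s j).1 l - m l ≤ ∑ l, ((s j).1 l - m l) := Finset.single_le_sum
      (f := fun l => (s j).1 l - m l) (fun _ _ => Nat.zero_le _) (Finset.mem_univ l)
    omega
  -- The deficit is placed at `j₀ ∈ C`, so the support stays in `C`.
  refine ⟨fun l => m l + Pi.single (M := fun _ => ℕ) j₀ (k - ∑ l, m l) l, ?_, fun i hi => ?_⟩
  · rw [Finset.sum_add_distrib]; simp; omega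
  · have hiC : i ∈ C := by
      by_contra h
      have : i ≠ j₀ := fun h' => h (h' ▸ hj₀)
      simp [m, h, this] at hi
    refine ⟨(s i).1, hT _, hs i hiC, fun l => ?_⟩
    have h0 := hsm i hiC l
    have h1 := hms i hiC l
    have h2 : Pi.single (M := fun _ => ℕ) j₀ (k - ∑ l, m l) l ≤ k - ∑ l, m l := by
      by_cases hl : l = j₀
      · subst hl; simp
      · simp [hl]
    dsimp only
    omega

/-- If open sets `U i` cover the standard simplex, then some point `p` of it
lies in `U i` for all `i` in its support. -/
theorem exists_mem_stdSimplex_forall_pos_mem {I : Type*} [Fintype I] [Nonempty I]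
    {U : I → Set (I → ℝ)} (hU : ∀ i, IsOpen (U i)) (hcov : stdSimplex ℝ I ⊆ ⋃ i, U i) :
    ∃ p ∈ stdSimplex ℝ I, ∀ i, 0 < p i → p ∈ U i := by
  classical
  obtain ⟨δ, hδ, hball⟩ := lebesgue_number_lemma_of_metric (isCompact_stdSimplex ℝ I) hU hcov
  -- Grid distance `Fintype.card I` scales to less than the Lebesgue number `δ`, so no limit is
  -- needed.
  obtain ⟨k, hk⟩ := exists_nat_gt ((Fintype.card I : ℝ) / δ)
  have hk0 : (0 : ℝ) < k := lt_of_le_of_lt (by positivity) hk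
  let φ : (I → ℕ) → I → ℝ := fun t i => (t i : ℝ) / k
  have hφ : ∀ t : I → ℕ, ∑ i, t i = k → φ t ∈ stdSimplex ℝ I := fun t ht => by
    refine ⟨fun i => by positivity, ?_⟩
    rw [← Finset.sum_div, ← Nat.cast_sum, ht, div_self hk0.ne']
  have hcol : ∀ t : I → ℕ, ∃ i, φ t ∈ stdSimplex ℝ I → Metric.ball (φ t) δ ⊆ U i := fun t => by
    by_cases h : φ t ∈ stdSimplex ℝ I
    · obtain ⟨i, hi⟩ := hball _ h
      exact ⟨i, fun _ => hi⟩
    · exact ⟨Classical.arbitrary I, fun h' => absurd h' h⟩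
  choose c hc using hcol
  obtain ⟨p, hpk, hp⟩ := Finset.exists_piAntidiag_colorful k c
  refine ⟨φ p, hφ p hpk, fun i hi => ?_⟩
  obtain ⟨s, hsk, rfl, hsp⟩ := hp i (by rintro h; simp [φ, h] at hi)
  refine hc s (hφ s hsk) ?_
  rw [Metric.mem_ball, dist_pi_lt_iff hδ]
  intro l
  have h1 : (s l : ℝ) ≤ p l + Fintype.card I := by exact_mod_cast (hsp l).1
  have h2 : (p l : ℝ) ≤ s l + Fintype.card I := by exact_mod_cast (hsp l).2
  rw [Real.dist_eq, ← sub_div, abs_div, abs_of_pos hk0, div_lt_iff₀ hk0]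
  rw [div_lt_iff₀ hδ] at hk
  rw [abs_lt]
  constructor <;> linarith

/-! ### Fan–Browder -/

/-- The Fan–Browder fixed point theorem. -/
theorem IsCompact.exists_mem_convexHull_of_open_fibers {E : Type*} [AddCommGroup E] [Module ℝ E]
    [TopologicalSpace E] [ContinuousAdd E] [ContinuousSMul ℝ E] {X : Set E}
    (hX : IsCompact X) (hconv : Convex ℝ X) (hne : X.Nonempty) {P : E → E → Prop}
    (hopen : ∀ x ∈ X, ∀ z ∈ X, P x z → ∀ᶠ x' in 𝓝[X] x, P x' z)
    (hex : ∀ x ∈ X, ∃ z ∈ X, P x z) :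
    ∃ x ∈ X, x ∈ convexHull ℝ {z | z ∈ X ∧ P x z} := by
  let O : X → Set E := fun z => interior {x | x ∈ X → P x z}
  obtain ⟨t, ht⟩ := hX.elim_finite_subcover O (fun _ => isOpen_interior) fun x hx => by
    obtain ⟨z, hz, hxz⟩ := hex x hx
    exact Set.mem_iUnion.2 ⟨⟨z, hz⟩, mem_interior_iff_mem_nhds.2
      (eventually_nhdsWithin_iff.1 (hopen x hx z hz hxz))⟩
  have : Nonempty t := by
    obtain ⟨x, hx⟩ := hne
    obtain ⟨z, hz, -⟩ := Set.mem_iUnion₂.1 (ht hx)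
    exact ⟨⟨z, hz⟩⟩
  let g : (t → ℝ) → E := fun p => ∑ i, p i • (i.1.1 : E)
  have hg : Continuous g := by fun_prop
  have hgX : ∀ p ∈ stdSimplex ℝ t, g p ∈ X := fun p hp =>
    hconv.sum_mem (fun i _ => hp.1 i) hp.2 (fun i _ => i.1.2)
  obtain ⟨p, hp, hpU⟩ := exists_mem_stdSimplex_forall_pos_mem (U := fun i : t => g ⁻¹' O i.1)
    (fun i => isOpen_interior.preimage hg) fun p hp => by
      obtain ⟨z, hz, h⟩ := Set.mem_iUnion₂.1 (ht (hgX p hp))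
      exact Set.mem_iUnion.2 ⟨⟨z, hz⟩, h⟩
  refine ⟨g p, hgX p hp, ?_⟩
  -- Only the `z` of positive weight are known to satisfy `P (g p) z`.
  have hsum : g p = ∑ i ∈ Finset.univ.filter fun i => p i ≠ 0, p i • (i.1.1 : E) := by
    rw [Finset.sum_filter_of_ne]
    intro i _ h h0
    simp [h0] at h
  rw [hsum]
  refine (convex_convexHull ℝ _).sum_mem (fun i _ => hp.1 i) ?_ fun i hi => ?_
  · rw [Finset.sum_filter_ne_zero]; exact hp.2
  · have hpos : 0 < p i := lt_of_le_of_ne (hp.1 i) (Finset.mem_filter.1 hi).2.symm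
    rw [← hsum]
    exact subset_convexHull ℝ _ ⟨i.1.2, interior_subset (hpU i hpos) (hgX p hp)⟩

/-! ### Clarke subdifferentials of Lipschitz functions -/

namespace ClarkeGame

section Variational

variable {E : Type*} [NormedAddCommGroup E] [InnerProductSpace ℝ E]

theorem eventually_abs_quotient_le {f : E → ℝ} {x : E} {O : Set E} {L : NNReal}
    (hO : O ∈ 𝓝 x) (hf : LipschitzOnWith L f O) (d : E) :
    ∀ᶠ p : E × ℝ in 𝓝 x ×ˢ 𝓝[>] (0 : ℝ), |(f (p.1 + p.2 • d) - f p.1) / p.2| ≤ L * ‖d‖ := by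
  have h1 : Tendsto (fun p : E × ℝ => p.1 + p.2 • d) (𝓝 x ×ˢ 𝓝[>] (0 : ℝ)) (𝓝 x) := by
    have : Tendsto (fun p : E × ℝ => p.1 + p.2 • d) (𝓝 x ×ˢ 𝓝 (0 : ℝ)) (𝓝 (x + (0 : ℝ) • d)) := by
      rw [← nhds_prod_eq]
      exact (Continuous.tendsto (by fun_prop) (x, (0 : ℝ)))
    rw [zero_smul, add_zero] at this
    exact this.mono_left (Filter.prod_mono le_rfl nhdsWithin_le_nhds)
  filter_upwards [h1 hO, tendsto_fst (f := 𝓝 x) (g := 𝓝[>] (0 : ℝ)) hO,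
    tendsto_snd (f := 𝓝 x) (g := 𝓝[>] (0 : ℝ)) self_mem_nhdsWithin] with p hp1 hp2 hp3
  have hp3 : 0 < p.2 := hp3
  rw [abs_div, abs_of_pos hp3, div_le_iff₀ hp3]
  have := hf.dist_le_mul _ hp1 _ hp2
  rw [Real.dist_eq, dist_eq_norm, add_sub_cancel_left, norm_smul, Real.norm_eq_abs,
    abs_of_pos hp3] at this
  linarith

theorem clarkeDirDeriv_le {f : E → ℝ} {x : E} {O : Set E} {L : NNReal}
    (hO : O ∈ 𝓝 x) (hf : LipschitzOnWith L f O) (d : E) :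
    clarkeDirDeriv f x d ≤ ((L * ‖d‖ : ℝ) : EReal) :=
  limsup_le_of_le (by isBoundedDefault) ((eventually_abs_quotient_le hO hf d).mono fun _ hp =>
    EReal.coe_le_coe_iff.2 (abs_le.1 hp).2)

theorem le_clarkeDirDeriv {f : E → ℝ} {x : E} {O : Set E} {L : NNReal}
    (hO : O ∈ 𝓝 x) (hf : LipschitzOnWith L f O) (d : E) :
    ((-(L * ‖d‖) : ℝ) : EReal) ≤ clarkeDirDeriv f x d :=
  le_limsup_of_frequently_le (((eventually_abs_quotient_le hO hf d).mono fun _ hp =>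
    EReal.coe_le_coe_iff.2 (abs_le.1 hp).1).frequently) (by isBoundedDefault)

/-- Split the quotient at `y + t e`; the shift `(y, t) ↦ (y + t e, t)` preserves the base filter.
The Lipschitz bounds exclude `∞ - ∞`. -/
theorem clarkeDirDeriv_add_le {f : E → ℝ} {x : E} {O : Set E} {L : NNReal}
    (hO : O ∈ 𝓝 x) (hf : LipschitzOnWith L f O) (d e : E) :
    clarkeDirDeriv f x (d + e) ≤ clarkeDirDeriv f x d + clarkeDirDeriv f x e := by
  let F := 𝓝 x ×ˢ 𝓝[>] (0 : ℝ)
  let q : E → E × ℝ → EReal := fun d p => (((f (p.1 + p.2 • d) - f p.1) / p.2 : ℝ) : EReal)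
  have hT : Tendsto (fun p : E × ℝ => (p.1 + p.2 • e, p.2)) F F := by
    refine Tendsto.prodMk ?_ tendsto_snd
    have : Tendsto (fun p : E × ℝ => p.1 + p.2 • e) (𝓝 x ×ˢ 𝓝 (0 : ℝ)) (𝓝 (x + (0 : ℝ) • e)) := by
      rw [← nhds_prod_eq]
      exact (Continuous.tendsto (by fun_prop) (x, (0 : ℝ)))
    rw [zero_smul, add_zero] at this
    exact this.mono_left (Filter.prod_mono le_rfl nhdsWithin_le_nhds)
  have h1 : limsup (fun p : E × ℝ => q d (p.1 + p.2 • e, p.2)) F ≤ clarkeDirDeriv f x d :=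
    limsup_le_limsup_of_le (u := q d) hT
  have htop : ∀ d, clarkeDirDeriv f x d ≠ ⊤ := fun d =>
    ((clarkeDirDeriv_le hO hf d).trans_lt (EReal.coe_lt_top _)).ne
  have hbot : ∀ d, clarkeDirDeriv f x d ≠ ⊥ := fun d =>
    ((EReal.bot_lt_coe _).trans_le (le_clarkeDirDeriv hO hf d)).ne'
  have h2 : clarkeDirDeriv f x (d + e) =
      limsup ((fun p : E × ℝ => q d (p.1 + p.2 • e, p.2)) + q e) F := by
    refine congrArg (fun u => limsup u F) (funext fun p => ?_)
    simp only [Pi.add_apply, q, ← EReal.coe_add, ← add_div]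
    rw [show p.1 + p.2 • (d + e) = p.1 + p.2 • e + p.2 • d by rw [smul_add]; abel]
    congr 2
    ring
  rw [h2]
  exact (EReal.limsup_add_le (.inr (htop e)) (.inr (hbot e))).trans (add_le_add h1 le_rfl)

/-- Substitute `t ↦ t c`. Applied to `c⁻¹` as well, this gives positive homogeneity. -/
theorem clarkeDirDeriv_smul_le {f : E → ℝ} {x : E} {c : ℝ} (hc : 0 < c) (d : E) :
    clarkeDirDeriv f x (c • d) ≤ c * clarkeDirDeriv f x d := by
  let F := 𝓝 x ×ˢ 𝓝[>] (0 : ℝ)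
  let q : E × ℝ → EReal := fun p => (((f (p.1 + p.2 • d) - f p.1) / p.2 : ℝ) : EReal)
  have hT : Tendsto (fun p : E × ℝ => (p.1, p.2 * c)) F F := by
    refine Tendsto.prodMk tendsto_fst (Tendsto.comp (g := fun t : ℝ => t * c) ?_ tendsto_snd)
    refine tendsto_nhdsWithin_iff.2 ⟨?_, ?_⟩
    · have : Tendsto (fun t : ℝ => t * c) (𝓝 0) (𝓝 (0 * c)) :=
        (continuous_mul_const c).tendsto 0
      rw [zero_mul] at this
      exact this.mono_left nhdsWithin_le_nhds
    · filter_upwards [self_mem_nhdsWithin] with t ht using mul_pos ht hc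
  have h1 : limsup (fun p : E × ℝ => q (p.1, p.2 * c)) F ≤ clarkeDirDeriv f x d :=
    limsup_le_limsup_of_le (u := q) hT
  have h2 : clarkeDirDeriv f x (c • d) =
      limsup (fun p : E × ℝ => (c : EReal) * q (p.1, p.2 * c)) F := by
    refine congrArg (fun u => limsup u F) (funext fun p => ?_)
    simp only [q, ← EReal.coe_mul, smul_smul]
    congr 1
    field_simp
  rw [h2, EReal.limsup_const_mul_of_nonneg_of_ne_top (EReal.coe_nonneg.2 hc.le)
    (EReal.coe_ne_top c)]
  exact mul_le_mul_of_nonneg_left h1 (EReal.coe_nonneg.2 hc.le)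

/-- The Clarke subdifferential of a function which is Lipschitz near the point is nonempty. -/
theorem clarkeSubdiff_nonempty [CompleteSpace E] {f : E → ℝ} {x : E} {O : Set E} {L : NNReal}
    (hO : O ∈ 𝓝 x) (hf : LipschitzOnWith L f O) : (clarkeSubdiff f x).Nonempty := by
  have hcoe : ∀ d, (((clarkeDirDeriv f x d).toReal : ℝ) : EReal) = clarkeDirDeriv f x d :=
    fun d => EReal.coe_toReal
      ((clarkeDirDeriv_le hO hf d).trans_lt (EReal.coe_lt_top _)).ne
      ((EReal.bot_lt_coe _).trans_le (le_clarkeDirDeriv hO hf d)).ne'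
  have hsmul : ∀ c : ℝ, 0 < c → ∀ d,
      (clarkeDirDeriv f x (c • d)).toReal ≤ c * (clarkeDirDeriv f x d).toReal := fun c hc d => by
    rw [← EReal.coe_le_coe_iff, EReal.coe_mul, hcoe, hcoe]
    exact clarkeDirDeriv_smul_le hc d
  -- Hahn–Banach from the zero subspace; Riesz then represents `g` by a vector.
  obtain ⟨g, -, hg⟩ := exists_extension_of_le_sublinear (E := E) ⊥
    (fun d => (clarkeDirDeriv f x d).toReal)
    (fun c hc d => by
      refine le_antisymm (hsmul c hc d) ?_
      have := hsmul c⁻¹ (inv_pos.2 hc) (c • d)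
      rwa [smul_smul, inv_mul_cancel₀ hc.ne', one_smul, le_inv_mul_iff₀ hc] at this)
    (fun d e => by
      rw [← EReal.coe_le_coe_iff, EReal.coe_add, hcoe, hcoe, hcoe]
      exact clarkeDirDeriv_add_le hO hf d e)
    (by
      rintro ⟨d, hd⟩
      obtain rfl : d = 0 := (Submodule.mem_bot ℝ).1 hd
      refine (LinearPMap.map_zero (⊥ : E →ₗ.[ℝ] ℝ)).le.trans ?_
      rw [← EReal.coe_le_coe_iff, hcoe]
      simpa using le_clarkeDirDeriv hO hf 0)
  have hle : ∀ d, g d ≤ L * ‖d‖ := fun d => (hg d).trans <| by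
    rw [← EReal.coe_le_coe_iff, hcoe]; exact clarkeDirDeriv_le hO hf d
  let G : StrongDual ℝ E := g.mkContinuous L fun d => by
    rw [Real.norm_eq_abs, abs_le]
    have := hle (-d)
    rw [map_neg, norm_neg] at this
    exact ⟨by linarith, hle d⟩
  refine ⟨(InnerProductSpace.toDual ℝ E).symm G, fun d => ?_⟩
  rw [InnerProductSpace.toDual_symm_apply, ← hcoe]
  exact EReal.coe_le_coe_iff.2 (hg d)

theorem isClosed_clarkeSubdiff (f : E → ℝ) (x : E) : IsClosed (clarkeSubdiff f x) := by
  have : clarkeSubdiff f x =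
      ⋂ d, {ζ : E | ((inner ℝ ζ d : ℝ) : EReal) ≤ clarkeDirDeriv f x d} := by
    ext; simp [clarkeSubdiff]
  rw [this]
  exact isClosed_iInter fun d => isClosed_le
    (continuous_coe_real_ereal.comp (by fun_prop)) continuous_const

theorem convex_clarkeSubdiff (f : E → ℝ) (x : E) : Convex ℝ (clarkeSubdiff f x) := by
  intro ζ hζ η hη a b ha hb hab d
  rcases le_total (inner ℝ ζ d) (inner ℝ η d) with h | h
  · refine le_trans (EReal.coe_le_coe_iff.2 ?_) (hη d)
    rw [inner_add_left, real_inner_smul_left, real_inner_smul_left]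
    obtain rfl : b = 1 - a := by linarith
    nlinarith
  · refine le_trans (EReal.coe_le_coe_iff.2 ?_) (hζ d)
    rw [inner_add_left, real_inner_smul_left, real_inner_smul_left]
    obtain rfl : b = 1 - a := by linarith
    nlinarith

theorem isCompact_clarkeSubdiff [FiniteDimensional ℝ E] {f : E → ℝ} {x : E} {O : Set E} {L : NNReal}
    (hO : O ∈ 𝓝 x) (hf : LipschitzOnWith L f O) : IsCompact (clarkeSubdiff f x) := by
  have := FiniteDimensional.proper_real E
  refine Metric.isCompact_of_isClosed_isBounded (isClosed_clarkeSubdiff f x)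
    ((Metric.isBounded_closedBall (x := 0) (r := (L : ℝ))).subset fun ζ hζ => ?_)
  rw [mem_closedBall_zero_iff]
  -- The direction `d = ζ` gives `‖ζ‖² ≤ L ‖ζ‖`.
  have h := EReal.coe_le_coe_iff.1 ((hζ ζ).trans (clarkeDirDeriv_le hO hf ζ))
  rw [real_inner_self_eq_norm_mul_norm] at h
  by_contra! hlt
  have := (NNReal.coe_nonneg L).trans_lt hlt
  nlinarith

end Variational

end ClarkeGame

/-! ### The variational inequality and the equilibrium -/

/-- Generalized variational inequalities on a compact convex set, with an upper hemicontinuous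
operator with nonempty compact convex values, are solvable. -/
theorem IsCompact.exists_variational_inequality {E F : Type*}
    [AddCommGroup E] [Module ℝ E] [TopologicalSpace E] [IsTopologicalAddGroup E]
    [ContinuousSMul ℝ E] [AddCommGroup F] [Module ℝ F] [TopologicalSpace F]
    [IsTopologicalAddGroup F] [ContinuousSMul ℝ F]
    (B : E →ₗ[ℝ] F →ₗ[ℝ] ℝ) (hB : Continuous fun p : E × F => B p.1 p.2)
    {X : Set E} (hX : IsCompact X) (hconv : Convex ℝ X) (hne : X.Nonempty) {K : E → Set F}
    (hK : UpperHemicontinuousOn K X) (hKc : ∀ x ∈ X, IsCompact (K x))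
    (hKconv : ∀ x ∈ X, Convex ℝ (K x)) (hKne : ∀ x ∈ X, (K x).Nonempty) :
    ∃ x ∈ X, ∃ y ∈ K x, ∀ z ∈ X, 0 ≤ B (z - x) y := by
  by_contra! hcon
  have hex : ∀ x ∈ X, ∃ z ∈ X, ∀ y ∈ K x, B (z - x) y < 0 := fun x hx => by
    obtain ⟨z, hz, y, hy, h⟩ := Sion.exists_isSaddlePointOn (X := X) (Y := K x)
      (f := fun z y => B (z - x) y) hne hconv hX
      (fun y _ => Continuous.lowerSemicontinuous
        (hB.comp (f := fun z => (z - x, y)) (by fun_prop)) |>.lowerSemicontinuousOn _)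
      (fun y _ => ConvexOn.quasiconvexOn ⟨hconv, fun u _ v _ a b _ _ hab => by
        have : a • u + b • v - x = a • (u - x) + b • (v - x) := by
          rw [smul_sub, smul_sub, sub_add_sub_comm, ← add_smul, hab, one_smul]
        simp only [this, map_add, map_smul, LinearMap.add_apply, LinearMap.smul_apply]
        exact le_rfl⟩)
      (hKconv x hx) (hKne x hx) (hKc x hx)
      (fun z _ => Continuous.upperSemicontinuous
        (hB.comp (f := fun y => (z - x, y)) (by fun_prop)) |>.upperSemicontinuousOn _)
      (fun z _ => ((B (z - x)).concaveOn (hKconv x hx)).quasiconcaveOn)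
    -- At the saddle point `(z, y)`, the value at `(z, y')` is at most that at `(w, y)`, which is
    -- negative.
    obtain ⟨w, hw, hlt⟩ := hcon x hx y hy
    exact ⟨z, hz, fun y' hy' => (h w hw y' hy').trans_lt hlt⟩
  obtain ⟨x, hx, hmem⟩ := hX.exists_mem_convexHull_of_open_fibers hconv hne
    (P := fun x z => ∀ y ∈ K x, B (z - x) y < 0)
    (fun x hx z _ hxz => by
      have hW : IsOpen {p : E × F | B (z - p.1) p.2 < 0} :=
        isOpen_lt (hB.comp (f := fun p : E × F => (z - p.1, p.2)) (by fun_prop)) continuous_const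
      obtain ⟨u, v, hu, hv, hxu, hKv, huv⟩ := generalized_tube_lemma (s := {x}) isCompact_singleton
        (hKc x hx) hW (by rintro ⟨a, b⟩ ⟨rfl, hb⟩; exact hxz b hb)
      filter_upwards [hK.forall_isOpen x hx v hv hKv,
        mem_nhdsWithin_of_mem_nhds (hu.mem_nhds (hxu rfl))] with x' h1 h2 y hy
      exact huv (Set.mk_mem_prod h2 (h1 hy)))
    hex
  obtain ⟨y, hy⟩ := hKne x hx
  have hhalf : Convex ℝ {z : E | B (z - x) y < 0} := by
    have : {z : E | B (z - x) y < 0} = {z : E | B.flip y z < B x y} := by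
      ext z; simp
    rw [this]
    exact convex_halfSpace_lt (B.flip y).isLinear _
  have := convexHull_min (fun z hz => hz.2 y hy) hhalf hmem
  simp at this

/-- A normal in the sense of convex analysis is a Fréchet normal: the inner product is nonpositive,
so every `ε` works. -/
theorem ClarkeGame.neg_mem_frechetNormalCone {E : Type*} [NormedAddCommGroup E]
    [InnerProductSpace ℝ E] {X : Set E} {x v : E} (hx : x ∈ X)
    (hv : ∀ z ∈ X, 0 ≤ inner ℝ v (z - x)) : -v ∈ ClarkeGame.frechetNormalCone X x := by
  refine ⟨hx, fun ε hε => ?_⟩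
  filter_upwards [self_mem_nhdsWithin] with z hz
  rw [inner_neg_left]
  have := hv z hz
  have : 0 ≤ ε * ‖z - x‖ := by positivity
  linarith

/-- The sum of the inner products of the components of two profiles. -/
noncomputable def ClarkeGame.profileInner {N : ℕ} (n : Fin N → ℕ) :
    ClarkeGame.Profile n →ₗ[ℝ] ClarkeGame.Profile n →ₗ[ℝ] ℝ :=
  LinearMap.mk₂ ℝ (fun z y => ∑ i, inner ℝ (y i) (z i))
    (fun a b c => by simp [inner_add_right, Finset.sum_add_distrib])
    (fun a b c => by simp [real_inner_smul_right, Finset.mul_sum])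
    (fun a b c => by simp [inner_add_left, Finset.sum_add_distrib])
    (fun a b c => by simp [real_inner_smul_left, Finset.mul_sum])

theorem ClarkeGame.profileInner_apply {N : ℕ} {n : Fin N → ℕ} (z y : ClarkeGame.Profile n) :
    ClarkeGame.profileInner n z y = ∑ i, inner ℝ (y i) (z i) := rfl

theorem mainTheorem8 (N : ℕ) (n : Fin N → ℕ)
    (X : ∀ i : Fin N, Set (EuclideanSpace ℝ (Fin (n i))))
    (f : Fin N → ClarkeGame.Profile n → ℝ)
    (hne : ∀ i, (X i).Nonempty)
    (hcompact : ∀ i, IsCompact (X i))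
    (hconvex : ∀ i, Convex ℝ (X i))
    -- each `f_i(•, x_{-i})`, `x_{-i} ∈ X_{-i}`, is Lipschitz on an open set containing `X i`;
    -- the constant and the open set may depend on `x_{-i}`
    (hLip : ∀ (i : Fin N) (x : ClarkeGame.Profile n), (∀ j, j ≠ i → x j ∈ X j) →
      ∃ (O : Set (EuclideanSpace ℝ (Fin (n i)))) (L : NNReal),
        IsOpen O ∧ X i ⊆ O ∧ LipschitzOnWith L (ClarkeGame.ownObjective f i x) O)
    -- the map `x ↦ ∏ i, ∂ᶜ_{x_i} f_i(x_i, x_{-i})` is upper semicontinuous on `∏ i, X i`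
    (husc : UpperHemicontinuousOn (ClarkeGame.subdiffMap f) (Set.univ.pi X)) :
    ∃ x : ClarkeGame.Profile n, ClarkeGame.IsClarkeNash X f x := by
  have hpi : ∀ x, ClarkeGame.subdiffMap f x =
      Set.univ.pi fun i => ClarkeGame.clarkeSubdiff (ClarkeGame.ownObjective f i x) (x i) :=
    fun x => by ext; simp [ClarkeGame.subdiffMap]
  have hloc : ∀ x ∈ Set.univ.pi X, ∀ i, ∃ O ∈ 𝓝 (x i), ∃ L : NNReal,
      LipschitzOnWith L (ClarkeGame.ownObjective f i x) O := fun x hx i => by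
    obtain ⟨O, L, hO, hXO, hL⟩ := hLip i x fun j _ => hx j trivial
    exact ⟨O, hO.mem_nhds (hXO (hx i trivial)), L, hL⟩
  -- A profile space has the sup norm, so a bilinear pairing replaces an inner product.
  obtain ⟨x, hx, y, hy, hvi⟩ := (isCompact_univ_pi hcompact).exists_variational_inequality
    (ClarkeGame.profileInner n)
    (by simp only [ClarkeGame.profileInner_apply]; fun_prop)
    (convex_pi fun i _ => hconvex i) (Set.univ_pi_nonempty_iff.2 hne) husc
    (fun x hx => by
      rw [hpi]
      refine isCompact_univ_pi fun i => ?_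
      obtain ⟨O, hO, L, hL⟩ := hloc x hx i
      exact ClarkeGame.isCompact_clarkeSubdiff hO hL)
    (fun x _ => by
      rw [hpi]
      exact convex_pi fun i _ => ClarkeGame.convex_clarkeSubdiff _ _)
    (fun x hx => by
      rw [hpi]
      refine Set.univ_pi_nonempty_iff.2 fun i => ?_
      obtain ⟨O, hO, L, hL⟩ := hloc x hx i
      exact ClarkeGame.clarkeSubdiff_nonempty hO hL)
  refine ⟨x, fun i => ⟨hx i trivial, Set.mem_add.2 ⟨y i, hy i, -y i, ?_, add_neg_cancel _⟩⟩⟩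
  refine ClarkeGame.neg_mem_frechetNormalCone (hx i trivial) fun z hz => ?_
  -- A deviation by player `i` alone leaves one summand.
  have h := hvi (Function.update x i z) fun j _ => by
    by_cases hj : j = i
    · subst hj; simpa using hz
    · simpa [hj] using hx j trivial
  rw [ClarkeGame.profileInner_apply, Finset.sum_eq_single i] at h
  · simpa using h
  · intro j _ hj
    simp [hj]
  · simp
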